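/- Let $d,T\in\mathbb N$ with $T\ge 1$, and let $p\ge 1$ be real. Write $x=(x_1,\dots,x_T)\in\mathbb R^{dT}$ for paths with $x_t\in\mathbb R^d$, let $|\cdot|_p$ be the $\ell_p$-norm (so $|x|_p^p=\sum_k|x_k|^p$ is the sum over all coordinates), and let $(X,Y)$ be the canonical process on $\mathbb R^{dT}\times\mathbb R^{dT}$. For probability measures $\mu,\nu$ on $\mathbb R^{dT}$ let $\mathrm{Cpl}(\mu,\nu)$ be the set of couplings of $\mu$ and $\nu$, and let $\mathrm{Cpl}_{\mathrm{bc}}(\mu,\nu)$ be the set of bicausal couplings, i.e. of those $\pi\in\mathrm{Cpl}(\mu,\nu)$ such that for all $t=1,\dots,T-1$, under $\pi$, the conditional law of $(Y_1,\dots,Y_t)$ given $X$ equals its conditional law given $(X_1,\dots,X_t)$, and the conditional law of $(X_1,\dots,X_t)$ given $Y$ equals its conditional law given $(Y_1,\dots,Y_t)$. Define $$\mathcal{AW}_p^p(\mu,\nu)=\inf_{\pi\in\mathrm{Cpl}_{\mathrm{bc}}(\mu,\nu)}\int|x-y|_p^p\,d\pi,$$ $$\mathrm{TV}_p^p(\mu,\nu)=\inf_{\pi\in\mathrm{Cpl}(\mu,\nu)}\int_{\{x\ne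 y\}}(2+|x|_p^p+|y|_p^p)\,d\pi,\qquad \mathrm{ATV}_p^p(\mu,\nu)=\inf_{\pi\in\mathrm{Cpl}_{\mathrm{bc}}(\mu,\nu)}\int_{\{x\ne y\}}(2+|x|_p^p+|y|_p^p)\,d\pi,$$ $$\mathrm{TV}(\mu,\nu)=|\mu-\nu|(\mathbb R^{dT}),\qquad \mathrm{ATV}(\mu,\nu)=\inf_{\pi\in\mathrm{Cpl}_{\mathrm{bc}}(\mu,\nu)}\int_{\{x\ne y\}}2\,d\pi.$$ Let $\mu,\nu$ have finite $p$-th moments, and for $t=2,\dots,T$ let $$c_t=\nu\text{-}\operatorname{ess\,sup}\ \frac{\mathbb E_\nu\big[|X_t|_p^p\,\big|\,X_1,\dots,X_{t-1}\big]}{1+\sum_{s=1}^{t-1}|X_s|_p^p}\in[0,\infty].$$ Then, with the convention $\infty\cdot 0=0$, $$\mathcal{AW}_p^p(\mu,\nu)\le 2^p\,\mathrm{ATV}_p^p(\mu,\nu)\le 2^p\Big(1+2\sum_{t=1}^{T-1}\prod_{s=t+1}^{T}(1+c_s)\Big)\mathrm{TV}_p^p(\mu,\nu).$$ If, moreover,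 $\mu$ and $\nu$ are concentrated on a Borel set $\mathcal K\subseteq\mathbb R^{dT}$ with $\mathrm{diam}(\mathcal K):=\sup_{x,y\in\mathcal K}|x-y|_p<\infty$, then $$\mathcal{AW}_p^p(\mu,\nu)\le\mathrm{diam}(\mathcal K)^p\,\mathrm{ATV}(\mu,\nu)\le(2T-1)\,\mathrm{diam}(\mathcal K)^p\,\mathrm{TV}(\mu,\nu).$$ -/

import Mathlib

open MeasureTheory ProbabilityTheory
open scoped ENNReal NNReal

noncomputable section

namespace AdaptedTV

/-- The path space `(ℝ^d)^T`, with its Borel (product) σ-algebra.  The coordinate with index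
`t : Fin T` is the value at the `(t+1)`-st time step. -/
abbrev PathSpace (d T : ℕ) : Type := Fin T → Fin d → ℝ

/-- `|v|_p^p = ∑ k, |v k|^p` for `v ∈ ℝ^d`. -/
def statePow {d : ℕ} (p : ℝ) (v : Fin d → ℝ) : ℝ≥0 := ∑ k, ‖v k‖₊ ^ p

/-- `|x|_p^p = ∑ t, ∑ k, |x t k|^p` for a path `x`. -/
def pathPow {d T : ℕ} (p : ℝ) (x : PathSpace d T) : ℝ≥0 := ∑ t, statePow p (x t)

/-- Finite `p`-th moment. -/
def HasFiniteMoment {d T : ℕ} (p : ℝ) (μ : Measure (PathSpace d T)) : Prop :=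
  Integrable (fun x => (pathPow p x : ℝ)) μ

/-- The σ-algebra on the path space generated by the first `n` time steps. -/
@[reducible] def pathSigma (d T n : ℕ) : MeasurableSpace (PathSpace d T) :=
  ⨆ (s : Fin T) (_ : s.val < n), MeasurableSpace.comap (fun x : PathSpace d T => x s) inferInstance

/-- `π` is a coupling of `μ` and `ν`. -/
def IsCoupling {d T : ℕ} (π : Measure (PathSpace d T × PathSpace d T))
    (μ ν : Measure (PathSpace d T)) : Prop :=
  π.map Prod.fst = μ ∧ π.map Prod.snd = ν

/-- `π` is a bicausal coupling of `μ` and `ν`: writing `(X, Y)` for the canonical process, for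
every `1 ≤ n ≤ T - 1` the conditional law of `(Y_1, …, Y_n)` given the whole of `X` is its
conditional law given `(X_1, …, X_n)`, and the same with `X` and `Y` exchanged. -/
structure IsBicausal {d T : ℕ} (π : Measure (PathSpace d T × PathSpace d T))
    (μ ν : Measure (PathSpace d T)) : Prop where
  coupling : IsCoupling π μ ν
  causal : ∀ n : ℕ, 1 ≤ n → n < T → ∀ B : Set (PathSpace d T), MeasurableSet[pathSigma d T n] B →
    π⟦Prod.snd ⁻¹' B | MeasurableSpace.comap Prod.fst inferInstance⟧
      =ᵐ[π] π⟦Prod.snd ⁻¹' B | MeasurableSpace.comap Prod.fst (pathSigma d T n)⟧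
  anticausal : ∀ n : ℕ, 1 ≤ n → n < T → ∀ B : Set (PathSpace d T),
    MeasurableSet[pathSigma d T n] B →
    π⟦Prod.fst ⁻¹' B | MeasurableSpace.comap Prod.snd inferInstance⟧
      =ᵐ[π] π⟦Prod.fst ⁻¹' B | MeasurableSpace.comap Prod.snd (pathSigma d T n)⟧

/-- The adapted Wasserstein distance of order `p`. -/
def adaptedWasserstein {d T : ℕ} (p : ℝ) (μ ν : Measure (PathSpace d T)) : ℝ≥0∞ :=
  (⨅ (π : Measure (PathSpace d T × PathSpace d T)) (_ : IsBicausal π μ ν),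
    ∫⁻ z, (pathPow p (z.1 - z.2) : ℝ≥0∞) ∂π) ^ (1 / p)

/-- The total variation distance with weight `w`, as an optimal transport value. -/
def weightedTV {d T : ℕ} (w : PathSpace d T → ℝ≥0) (μ ν : Measure (PathSpace d T)) : ℝ≥0∞ :=
  ⨅ (π : Measure (PathSpace d T × PathSpace d T)) (_ : IsCoupling π μ ν),
    ∫⁻ z in {z | z.1 ≠ z.2}, ((w z.1 + w z.2 : ℝ≥0) : ℝ≥0∞) ∂π

/-- The adapted total variation distance with weight `w`. -/
def weightedATV {d T : ℕ} (w : PathSpace d T → ℝ≥0) (μ ν : Measure (PathSpace d T)) : ℝ≥0∞ :=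
  ⨅ (π : Measure (PathSpace d T × PathSpace d T)) (_ : IsBicausal π μ ν),
    ∫⁻ z in {z | z.1 ≠ z.2}, ((w z.1 + w z.2 : ℝ≥0) : ℝ≥0∞) ∂π

/-- The total variation `|μ - ν|(ℝ^{dT})`; it has values in `[0, 2]` on probability measures. -/
def tv {d T : ℕ} (μ ν : Measure (PathSpace d T)) [IsFiniteMeasure μ] [IsFiniteMeasure ν] : ℝ≥0∞ :=
  (μ.toSignedMeasure - ν.toSignedMeasure).totalVariation Set.univ

/-- The adapted total variation: weight `w ≡ 1`. -/
def atv {d T : ℕ} (μ ν : Measure (PathSpace d T)) : ℝ≥0∞ := weightedATV (fun _ => 1) μ ν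

/-- The `p`-th order total variation distance: `p`-th root for the weight `1 + |x|_p^p`. -/
def tvOrder {d T : ℕ} (p : ℝ) (μ ν : Measure (PathSpace d T)) : ℝ≥0∞ :=
  (weightedTV (fun x => 1 + pathPow p x) μ ν) ^ (1 / p)

/-- The `p`-th order adapted total variation distance. -/
def atvOrder {d T : ℕ} (p : ℝ) (μ ν : Measure (PathSpace d T)) : ℝ≥0∞ :=
  (weightedATV (fun x => 1 + pathPow p x) μ ν) ^ (1 / p)

/-- The constant
`ν-ess sup E_ν[|X_t|^p | X_s, s < t] / (1 + ∑_{s < t} |X_s|^p)`, possibly `∞`. -/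
def momentConst {d T : ℕ} (p : ℝ) (ν : Measure (PathSpace d T)) (t : Fin T) : ℝ≥0∞ :=
  essSup (fun x => ENNReal.ofReal
    ((ν[fun x' : PathSpace d T => (statePow p (x' t) : ℝ) | pathSigma d T t.val]) x /
      (1 + ∑ s ∈ Finset.univ.filter (fun s : Fin T => s < t), (statePow p (x s) : ℝ)))) ν

/-- The diameter of a set of paths in the norm `|x|_p`. -/
def lpDiam {d T : ℕ} (p : ℝ) (K : Set (PathSpace d T)) : ℝ≥0∞ :=
  ⨆ (x ∈ K) (y ∈ K), (pathPow p (x - y) : ℝ≥0∞) ^ (1 / p)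

end AdaptedTV

end

/-! Write `μ = c + δ₁` and `ν = c + δ₂` with a common part `c`. An ordinary coupling can keep all of
`c` on the diagonal. A bicausal one is assembled from couplings of the one-step kernels `κ` of `μ`
and `η` of `ν`, and loses some of it. Here paths that agree so far move together by the greatest
common part `θ` of the kernels, and paths that differ move independently (`exists_kernel_coupling`).

The loss is tracked by a measure `r` such that `diagPart π + r` dominates both marginals of the
current coupling. The next `c` then lies below `(diagPart π + r) ⊗ₘ κ` and `(diagPart π + r) ⊗ₘ η`,
hence below `(diagPart π + r) ⊗ₘ θ`, which is at most the new diagonal part plus `r ⊗ₘ η`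
(`exists_extension`). So `δ₁ + δ₂ + r ⊗ₘ η`, up to identifying path spaces, is the next `r`. Each
step of `η` multiplies weights by at most `1 + momentConst`, and iteration gives the sum of products
(`exists_prefixCausal_coupling`). Since `η` alone carries the remainder, only `ν` enters the
constant.

The off-diagonal cost is the weight of both marginals minus twice that of the diagonal part, hence
at most `1 + 2 * growthSum` times the weight of `δ₁ + δ₂` (`weightedATV_le_of_decomposition`). The
Jordan decomposition of `μ - ν` makes `δ₁ + δ₂` minimal, so its weight is at most `weightedTV` and
its mass is `tv`. -/

namespace AdaptedTV

/-! ### Measurable coupling of two kernels -/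

section KernelCoupling

variable {A E : Type*} [MeasurableSpace A] [MeasurableSpace E]

/-- Two Markov kernels have a greatest common part `θ`. -/
lemma exists_kernel_inf [StandardBorelSpace E] (κ η : Kernel A E) [IsFiniteKernel κ]
    [IsFiniteKernel η] :
    ∃ θ α β : Kernel A E, IsFiniteKernel θ ∧ IsFiniteKernel α ∧ IsFiniteKernel β ∧
      θ + α = κ ∧ θ + β = η ∧
      ∀ (s : Measure A) (c : Measure (A × E)) [SFinite s],
        c ≤ s ⊗ₘ κ → c ≤ s ⊗ₘ η → c ≤ s ⊗ₘ θ := by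
  -- Both kernels have jointly measurable densities `f`, `g` with respect to their sum; `θ` has
  -- density `min f g`, the residuals the truncated differences.
  set ρ := κ + η with hρ
  set f := Kernel.rnDeriv κ ρ with hf
  set g := Kernel.rnDeriv η ρ with hg
  have hfm : Measurable (Function.uncurry f) := Kernel.measurable_rnDeriv κ ρ
  have hgm : Measurable (Function.uncurry g) := Kernel.measurable_rnDeriv η ρ
  have hκρ : ∀ a, κ a ≪ ρ a := fun a => by
    rw [hρ, _root_.add_apply]
    exact (Measure.AbsolutelyContinuous.rfl).add_right _
  have hηρ : ∀ a, η a ≪ ρ a := fun a => by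
    rw [hρ, _root_.add_apply, add_comm]
    exact (Measure.AbsolutelyContinuous.rfl).add_right _
  have hκ : ρ.withDensity f = κ := Kernel.ext fun a => Kernel.withDensity_rnDeriv_eq (hκρ a)
  have hη : ρ.withDensity g = η := Kernel.ext fun a => Kernel.withDensity_rnDeriv_eq (hηρ a)
  have hmin : Measurable (Function.uncurry fun a x => min (f a x) (g a x)) := hfm.min hgm
  have hfg : Measurable (Function.uncurry fun a x => f a x - g a x) := hfm.sub hgm
  have hgf : Measurable (Function.uncurry fun a x => g a x - f a x) := hgm.sub hfm
  set θ := ρ.withDensity fun a x => min (f a x) (g a x) with hθ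
  set α := ρ.withDensity fun a x => f a x - g a x with hα
  set β := ρ.withDensity fun a x => g a x - f a x with hβ
  have h1 : θ + α = κ := by
    rw [hθ, hα, ← Kernel.withDensity_add_right hmin hfg]
    refine Eq.trans ?_ hκ
    congr 1
    ext a x
    simp only [Pi.add_apply]
    rw [add_comm, tsub_add_min]
  have h2 : θ + β = η := by
    rw [hθ, hβ, ← Kernel.withDensity_add_right hmin hgf]
    refine Eq.trans ?_ hη
    congr 1
    ext a x
    simp only [Pi.add_apply]
    rw [add_comm, min_comm, tsub_add_min]
  have fin_of_le : ∀ γ γ' : Kernel A E, IsFiniteKernel γ → γ' ≤ γ → IsFiniteKernel γ' := by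
    intro γ γ' hγ h
    exact ⟨γ.bound, γ.bound_lt_top, fun a => (h a Set.univ).trans (γ.measure_le_bound a _)⟩
  have hθκ : θ ≤ κ := fun a => by rw [← h1, _root_.add_apply]; exact Measure.le_add_right le_rfl
  have hακ : α ≤ κ := fun a => by rw [← h1, _root_.add_apply]; exact Measure.le_add_left le_rfl
  have hβη : β ≤ η := fun a => by rw [← h2, _root_.add_apply]; exact Measure.le_add_left le_rfl
  have hθf : IsFiniteKernel θ := fin_of_le κ θ ‹_› hθκ
  refine ⟨θ, α, β, hθf, fin_of_le κ α ‹_› hακ, fin_of_le η β ‹_› hβη, h1, h2, ?_⟩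
  intro s c _ hcκ hcη
  -- `θ` agrees with `κ` where `f ≤ g` and with `η` elsewhere, so the two bounds on `c` combine.
  have hH : MeasurableSet {p : A × E | f p.1 p.2 ≤ g p.1 p.2} := measurableSet_le hfm hgm
  set H := {p : A × E | f p.1 p.2 ≤ g p.1 p.2} with hHdef
  have e1 : ∀ S ⊆ H, MeasurableSet S → (s ⊗ₘ κ) S = (s ⊗ₘ θ) S := by
    intro S hSH hS
    rw [Measure.compProd_apply hS, Measure.compProd_apply hS]
    refine lintegral_congr fun a => ?_
    rw [← hκ, hθ, Kernel.withDensity_apply' _ hfm, Kernel.withDensity_apply' _ hmin]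
    refine setLIntegral_congr_fun (measurable_prodMk_left hS) fun x hx => ?_
    exact (min_eq_left (hSH hx)).symm
  have e2 : ∀ S ⊆ Hᶜ, MeasurableSet S → (s ⊗ₘ η) S = (s ⊗ₘ θ) S := by
    intro S hSH hS
    rw [Measure.compProd_apply hS, Measure.compProd_apply hS]
    refine lintegral_congr fun a => ?_
    rw [← hη, hθ, Kernel.withDensity_apply' _ hgm, Kernel.withDensity_apply' _ hmin]
    refine setLIntegral_congr_fun (measurable_prodMk_left hS) fun x hx => ?_
    have : ¬ f a x ≤ g a x := hSH hx
    exact (min_eq_right (not_le.1 this).le).symm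
  refine Measure.le_iff.2 fun S hS => ?_
  rw [← measure_inter_add_sdiff S hH, ← measure_inter_add_sdiff (μ := s ⊗ₘ θ) S hH,
    ← e1 _ Set.inter_subset_right (hS.inter hH),
    ← e2 _ (fun x hx => hx.2) (hS.diff hH)]
  exact add_le_add (hcκ _) (hcη _)

/-- A measurable family of couplings of `κ x` and `η y`, which for `x = y` charges the diagonal
at least by the greatest common part of `κ x` and `η x`. -/
lemma exists_kernel_coupling [StandardBorelSpace A] [StandardBorelSpace E] (κ η : Kernel A E)
    [IsMarkovKernel κ] [IsMarkovKernel η] :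
    ∃ (K : Kernel (A × A) (E × E)) (θ : Kernel A E), IsMarkovKernel K ∧ IsFiniteKernel θ ∧
      (∀ z, (K z).map Prod.fst = κ z.1) ∧ (∀ z, (K z).map Prod.snd = η z.2) ∧
      (∀ x, (θ x).map (fun e => (e, e)) ≤ K (x, x)) ∧
      ∀ (s : Measure A) (c : Measure (A × E)) [SFinite s],
        c ≤ s ⊗ₘ κ → c ≤ s ⊗ₘ η → c ≤ s ⊗ₘ θ := by
  obtain ⟨θ, α, β, _, _, _, h1, h2, h3⟩ := exists_kernel_inf κ η
  have hαβ : ∀ x, α x Set.univ = β x Set.univ := by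
    intro x
    have e1 : θ x Set.univ + α x Set.univ = 1 := by
      rw [← Measure.add_apply, ← _root_.add_apply, h1, measure_univ]
    have e2 : θ x Set.univ + β x Set.univ = 1 := by
      rw [← Measure.add_apply, ← _root_.add_apply, h2, measure_univ]
    exact (ENNReal.add_right_inj (measure_ne_top (θ x) _)).1 (e1.trans e2.symm)
  have hd : Measurable (fun e : E => (e, e)) := measurable_id.prodMk measurable_id
  have hm : Measurable (Function.uncurry fun (x : A) (_ : E × E) => (α x Set.univ)⁻¹) :=
    ((Kernel.measurable_coe α MeasurableSet.univ).inv).comp measurable_fst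
  -- The residuals have equal mass, so dividing their product by it restores both marginals. At mass
  -- zero the residuals vanish, and the infinite inverse is harmless.
  set R : Kernel A (E × E) := (α ×ₖ β).withDensity fun x _ => (α x Set.univ)⁻¹ with hR
  have hRx : ∀ x, R x = (α x Set.univ)⁻¹ • (α x).prod (β x) := by
    intro x
    rw [hR, Kernel.withDensity_apply _ hm, Kernel.prod_apply, withDensity_const]
  have hmass : ∀ x, (α x Set.univ)⁻¹ • (β x Set.univ) • α x = α x := by
    intro x
    rw [← hαβ, smul_smul]
    by_cases h0 : α x Set.univ = 0
    · rw [Measure.measure_univ_eq_zero.1 h0, smul_zero]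
    · rw [ENNReal.inv_mul_cancel h0 (measure_ne_top _ _), one_smul]
  have hmass' : ∀ x, (α x Set.univ)⁻¹ • (α x Set.univ) • β x = β x := by
    intro x
    rw [hαβ, smul_smul]
    by_cases h0 : β x Set.univ = 0
    · rw [Measure.measure_univ_eq_zero.1 h0, smul_zero]
    · rw [ENNReal.inv_mul_cancel h0 (measure_ne_top _ _), one_smul]
  set K1 : Kernel A (E × E) := θ.map (fun e => (e, e)) + R with hK1
  have hK1x : ∀ x, K1 x = (θ x).map (fun e => (e, e)) + R x := fun x => by
    rw [hK1, _root_.add_apply, Kernel.map_apply _ hd]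
  have hK1f : ∀ x, (K1 x).map Prod.fst = κ x := by
    intro x
    rw [hK1x, Measure.map_add _ _ measurable_fst, Measure.map_map measurable_fst hd, hRx,
      Measure.map_smul, Measure.map_fst_prod, hmass, ← h1, _root_.add_apply]
    congr 1
    exact Measure.map_id
  have hK1s : ∀ x, (K1 x).map Prod.snd = η x := by
    intro x
    rw [hK1x, Measure.map_add _ _ measurable_snd, Measure.map_map measurable_snd hd, hRx,
      Measure.map_smul, Measure.map_snd_prod, hmass', ← h2, _root_.add_apply]
    congr 1
    exact Measure.map_id
  have hdiag : MeasurableSet {z : A × A | z.1 = z.2} := measurableSet_eq_fun measurable_fst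
    measurable_snd
  classical
  set K : Kernel (A × A) (E × E) := Kernel.piecewise hdiag (K1.comap Prod.fst measurable_fst)
    ((κ.comap Prod.fst measurable_fst) ×ₖ (η.comap Prod.snd measurable_snd)) with hK
  have hKf : ∀ z, (K z).map Prod.fst = κ z.1 := by
    intro z
    rw [hK, Kernel.piecewise_apply]
    split_ifs with h
    · rw [Kernel.comap_apply, hK1f]
    · rw [Kernel.prod_apply, Measure.map_fst_prod]
      simp
  have hKs : ∀ z, (K z).map Prod.snd = η z.2 := by
    intro z
    rw [hK, Kernel.piecewise_apply]
    split_ifs with h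
    · rw [Kernel.comap_apply, hK1s, show z.1 = z.2 from h]
    · rw [Kernel.prod_apply, Measure.map_snd_prod]
      simp
  refine ⟨K, θ, ⟨fun z => ⟨?_⟩⟩, ‹_›, hKf, hKs, fun x => ?_, h3⟩
  · have := measure_univ (μ := κ z.1)
    rwa [← hKf, Measure.map_apply measurable_fst MeasurableSet.univ, Set.preimage_univ] at this
  · rw [hK, Kernel.piecewise_apply, if_pos (by simp), Kernel.comap_apply, hK1x]
    exact Measure.le_add_right le_rfl

end KernelCoupling

/-! ### Filtration of the path space and splitting off the last step -/

lemma pathSigma_le (d T n : ℕ) : pathSigma d T n ≤ MeasurableSpace.pi :=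
  iSup₂_le fun s _ => (measurable_pi_apply s).comap_le

lemma pathSigma_eq_pi {d T n : ℕ} (h : T ≤ n) : pathSigma d T n = MeasurableSpace.pi := by
  refine le_antisymm (pathSigma_le d T n) ?_
  exact iSup_le fun s => le_iSup₂_of_le s (s.2.trans_le h) le_rfl

lemma measurable_coord {d T n : ℕ} (s : Fin T) (hs : s.val < n) :
    Measurable[pathSigma d T n] fun x : PathSpace d T => x s :=
  measurable_iff_comap_le.2 <| le_iSup₂ (f := fun (i : Fin T) (_ : i.val < n) =>
    MeasurableSpace.comap (fun x : PathSpace d T => x i) inferInstance) s hs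

lemma pathSigma_succ {d T n : ℕ} (h : n ≤ T) :
    pathSigma d (T + 1) n = (pathSigma d T n).comap Fin.init := by
  refine le_antisymm (iSup₂_le fun s hs => ?_) ?_
  · refine measurable_iff_comap_le.1 ?_
    exact (measurable_coord (⟨s, hs.trans_le h⟩ : Fin T) hs).comp (comap_measurable _)
  · refine MeasurableSpace.comap_le_iff_le_map.2 (iSup₂_le fun s hs => ?_)
    refine measurable_iff_comap_le.1 fun S hS => ?_
    exact measurable_coord s.castSucc hs hS

/-- Splitting off the last time step. -/
def pathSplit (d T : ℕ) : PathSpace d (T + 1) ≃ᵐ PathSpace d T × (Fin d → ℝ) where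
  toFun x := (Fin.init x, x (Fin.last T))
  invFun z := Fin.snoc (α := fun _ => Fin d → ℝ) z.1 z.2
  left_inv x := Fin.snoc_init_self x
  right_inv z := by simp
  measurable_toFun := (measurable_pi_lambda _ fun i => measurable_pi_apply i.castSucc).prodMk
    (measurable_pi_apply _)
  measurable_invFun := by
    refine measurable_pi_lambda _ fun i => ?_
    refine Fin.lastCases ?_ (fun j => ?_) i
    · simpa using measurable_snd
    · have h : Measurable fun z : PathSpace d T × (Fin d → ℝ) => z.1 j :=
        (measurable_pi_apply j).comp measurable_fst
      simpa using h

lemma pathSplit_symm_apply {d T : ℕ} (z : PathSpace d T × (Fin d → ℝ)) :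
    (pathSplit d T).symm z = Fin.snoc (α := fun _ => Fin d → ℝ) z.1 z.2 := rfl

lemma init_pathSplit_symm {d T : ℕ} (z : PathSpace d T × (Fin d → ℝ)) :
    Fin.init ((pathSplit d T).symm z) = z.1 :=
  congrArg Prod.fst ((pathSplit d T).apply_symm_apply z)

lemma measurable_init {d T : ℕ} :
    Measurable (Fin.init : PathSpace d (T + 1) → PathSpace d T) :=
  measurable_fst.comp (pathSplit d T).measurable

/-! ### Causality in terms of densities -/

/-- For every event `B` of the first `n` time steps, the conditional probability of `Y ∈ B`
given `X` has a version which depends on the first `n` time steps of `X` only. -/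
def PrefixCausal {d T : ℕ} {Ω : Type*} [MeasurableSpace Ω] (ρ : Measure Ω)
    (X Y : Ω → PathSpace d T) : Prop :=
  ∀ (n : ℕ) (B : Set (PathSpace d T)), MeasurableSet[pathSigma d T n] B →
    ∃ k : PathSpace d T → ℝ≥0∞, Measurable[pathSigma d T n] k ∧
      (ρ.restrict (Y ⁻¹' B)).map X = (ρ.map X).withDensity k

section

variable {d T : ℕ} {Ω Z : Type*} [MeasurableSpace Ω] [MeasurableSpace Z]

lemma PrefixCausal.map {ρ : Measure Z} {φ : Z → Ω} {X Y : Ω → PathSpace d T}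
    (h : PrefixCausal ρ (X ∘ φ) (Y ∘ φ)) (hφ : Measurable φ) (hX : Measurable X)
    (hY : Measurable Y) : PrefixCausal (ρ.map φ) X Y := by
  intro n B hB
  obtain ⟨k, hk, e⟩ := h n B hB
  refine ⟨k, hk, ?_⟩
  rw [Measure.restrict_map hφ (hY (pathSigma_le _ _ _ _ hB)), Measure.map_map hX hφ,
    Measure.map_map hX hφ, ← e]
  rfl

/-- Any conditional probability is a version for the full past. -/
lemma exists_withDensity_of_full (ρ : Measure Ω) [IsFiniteMeasure ρ] {X : Ω → PathSpace d T}
    (hX : Measurable X) (S : Set Ω) :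
    ∃ k : PathSpace d T → ℝ≥0∞, Measurable k ∧
      (ρ.restrict S).map X = (ρ.map X).withDensity k := by
  refine ⟨((ρ.restrict S).map X).rnDeriv (ρ.map X), Measure.measurable_rnDeriv _ _, ?_⟩
  refine (Measure.withDensity_rnDeriv_eq _ _ ?_).symm
  exact Measure.absolutelyContinuous_of_le (Measure.map_mono Measure.restrict_le_self hX)

lemma prefixCausal_zero (ρ : Measure Ω) [IsFiniteMeasure ρ] {X Y : Ω → PathSpace d 0}
    (hX : Measurable X) : PrefixCausal ρ X Y := by
  intro n B _
  obtain ⟨k, hk, e⟩ := exists_withDensity_of_full ρ hX (Y ⁻¹' B)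
  refine ⟨k, ?_, e⟩
  rw [pathSigma_eq_pi (Nat.zero_le n)]
  exact hk

lemma map_compProd_of_map_eq {A E : Type*} [MeasurableSpace A] [MeasurableSpace E]
    (ρ : Measure Ω) [SFinite ρ] (K : Kernel Ω Z) [IsSFiniteKernel K] (κ : Kernel A E)
    [IsSFiniteKernel κ] {X : Ω → A} {U : Z → E} (hX : Measurable X) (hU : Measurable U)
    (hK : ∀ ω, (K ω).map U = κ (X ω)) :
    (ρ ⊗ₘ K).map (Prod.map X U) = (ρ.map X) ⊗ₘ κ := by
  ext S hS
  rw [Measure.map_apply (hX.prodMap hU) hS, Measure.compProd_apply ((hX.prodMap hU) hS),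
    Measure.compProd_apply hS, lintegral_map (Kernel.measurable_kernel_prodMk_left hS) hX]
  refine lintegral_congr fun ω => ?_
  rw [← hK, Measure.map_apply hU (measurable_prodMk_left hS)]
  rfl

lemma restrict_fst_compProd (ρ : Measure Ω) [SFinite ρ] (K : Kernel Ω Z) [IsSFiniteKernel K]
    {S : Set Ω} (hS : MeasurableSet S) :
    (ρ ⊗ₘ K).restrict (Prod.fst ⁻¹' S) = (ρ.restrict S) ⊗ₘ K := by
  ext R hR
  rw [Measure.restrict_apply hR, Measure.compProd_apply (hR.inter (measurable_fst hS)),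
    Measure.compProd_apply hR, ← lintegral_indicator hS]
  refine lintegral_congr fun ω => ?_
  by_cases h : ω ∈ S <;> simp [h, Set.preimage_inter, Set.preimage_preimage]

lemma withDensity_compProd {A E : Type*} [MeasurableSpace A] [MeasurableSpace E]
    (a : Measure A) [SFinite a] (κ : Kernel A E) [IsSFiniteKernel κ] {k : A → ℝ≥0∞}
    (hk : Measurable k) :
    (a.withDensity k) ⊗ₘ κ = (a ⊗ₘ κ).withDensity (k ∘ Prod.fst) := by
  ext S hS
  have hm := Kernel.measurable_kernel_prodMk_left (κ := κ) hS
  rw [Measure.compProd_apply hS, lintegral_withDensity_eq_lintegral_mul _ hk hm,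
    withDensity_apply _ hS, ← lintegral_indicator hS, Measure.lintegral_compProd
      ((hk.comp measurable_fst).indicator hS)]
  refine lintegral_congr fun x => ?_
  have : ∀ e, S.indicator (k ∘ Prod.fst) (x, e) = (Prod.mk x ⁻¹' S).indicator (fun _ => k x) e :=
    fun e => rfl
  simp_rw [this]
  rw [lintegral_indicator_const (measurable_prodMk_left hS)]
  rfl

/-- Extending two paths by one time step keeps prefix causality if, given the past, the new value
of `X` depends on the past of `X` only. -/
lemma PrefixCausal.extend {ρ : Measure Ω} [IsFiniteMeasure ρ] {X Y : Ω → PathSpace d T}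
    (h : PrefixCausal ρ X Y) (hX : Measurable X) (hY : Measurable Y)
    (K : Kernel Ω Z) [IsMarkovKernel K] (κ : Kernel (PathSpace d T) (Fin d → ℝ))
    [IsMarkovKernel κ] {U V : Z → Fin d → ℝ} (hU : Measurable U)
    (hK : ∀ ω, (K ω).map U = κ (X ω)) :
    PrefixCausal (ρ ⊗ₘ K) ((pathSplit d T).symm ∘ Prod.map X U)
      ((pathSplit d T).symm ∘ Prod.map Y V) := by
  have hXU : Measurable ((pathSplit d T).symm ∘ Prod.map X U) :=
    (pathSplit d T).symm.measurable.comp (hX.prodMap hU)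
  intro n B hB
  -- For `n > T` the first `n` steps are the whole path, and causality is no restriction.
  rcases Nat.lt_or_ge T n with hn | hn
  · obtain ⟨k, hk, e⟩ := exists_withDensity_of_full (ρ ⊗ₘ K) hXU
      (((pathSplit d T).symm ∘ Prod.map Y V) ⁻¹' B)
    refine ⟨k, ?_, e⟩
    rw [pathSigma_eq_pi hn]
    exact hk
  · rw [pathSigma_succ hn] at hB ⊢
    obtain ⟨B, hB, rfl⟩ := hB
    obtain ⟨k, hk, e⟩ := h n B hB
    have hB' := pathSigma_le _ _ _ _ hB
    have hk' : Measurable k := hk.mono (pathSigma_le _ _ _) le_rfl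
    refine ⟨k ∘ Fin.init, hk.comp (comap_measurable _), ?_⟩
    -- As `n ≤ T`, the event does not see the new values. Restricting to it therefore commutes with
    -- the extension, and the density `k` persists.
    have e1 : ((pathSplit d T).symm ∘ Prod.map Y V) ⁻¹' (Fin.init ⁻¹' B) =
        (Prod.fst ⁻¹' (Y ⁻¹' B) : Set (Ω × Z)) := by
      ext z
      simp only [Set.mem_preimage, Function.comp_apply]
      rw [init_pathSplit_symm]
      rfl
    rw [e1, restrict_fst_compProd _ _ (hY hB'),
      ← Measure.map_map (pathSplit d T).symm.measurable (hX.prodMap hU),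
      ← Measure.map_map (pathSplit d T).symm.measurable (hX.prodMap hU),
      map_compProd_of_map_eq _ K κ hX hU hK, map_compProd_of_map_eq _ K κ hX hU hK, e,
      withDensity_compProd _ _ hk']
    ext S hS
    rw [Measure.map_apply (pathSplit d T).symm.measurable hS, withDensity_apply _ hS,
      withDensity_apply _ ((pathSplit d T).symm.measurable hS),
      setLIntegral_map hS (hk'.comp measurable_init) (pathSplit d T).symm.measurable]
    refine lintegral_congr fun z => ?_
    simp only [Function.comp_apply]
    rw [init_pathSplit_symm]

end

/-! ### Diagonal part and one-step extension -/

/-- The law of the first coordinate on the diagonal. -/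
noncomputable def diagPart {A : Type*} [MeasurableSpace A] (π : Measure (A × A)) : Measure A :=
  (π.restrict {z | z.1 = z.2}).map Prod.fst

lemma measurableSet_diag {A : Type*} [MeasurableSpace A] [StandardBorelSpace A] :
    MeasurableSet {z : A × A | z.1 = z.2} :=
  measurableSet_eq_fun measurable_fst measurable_snd

instance {A : Type*} [MeasurableSpace A] (π : Measure (A × A)) [IsFiniteMeasure π] :
    IsFiniteMeasure (diagPart π) := by
  unfold diagPart
  infer_instance

lemma compProd_mono {A E : Type*} [MeasurableSpace A] [MeasurableSpace E] {a b : Measure A}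
    [SFinite a] [SFinite b] {κ η : Kernel A E} [IsSFiniteKernel κ] [IsSFiniteKernel η]
    (h : a ≤ b) (h' : ∀ x, κ x ≤ η x) : a ⊗ₘ κ ≤ b ⊗ₘ η := by
  refine Measure.le_iff.2 fun S hS => ?_
  rw [Measure.compProd_apply hS, Measure.compProd_apply hS]
  exact lintegral_mono' h fun x => h' x _

section

variable {d T : ℕ}

/-- Extends a pair of paths by a pair of values. -/
def pairExtend (d T : ℕ) (z : (PathSpace d T × PathSpace d T) × ((Fin d → ℝ) × (Fin d → ℝ))) :
    PathSpace d (T + 1) × PathSpace d (T + 1) :=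
  ((pathSplit d T).symm (z.1.1, z.2.1), (pathSplit d T).symm (z.1.2, z.2.2))

lemma measurable_pairExtend : Measurable (pairExtend d T) :=
  ((pathSplit d T).symm.measurable.comp (by fun_prop)).prodMk
    ((pathSplit d T).symm.measurable.comp (by fun_prop))

lemma diagPart_compProd_le (π : Measure (PathSpace d T × PathSpace d T)) [SFinite π]
    (K : Kernel (PathSpace d T × PathSpace d T) ((Fin d → ℝ) × (Fin d → ℝ))) [IsSFiniteKernel K]
    (θ : Kernel (PathSpace d T) (Fin d → ℝ)) [IsSFiniteKernel θ]
    (h : ∀ x, (θ x).map (fun e => (e, e)) ≤ K (x, x)) :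
    (diagPart π ⊗ₘ θ).map (pathSplit d T).symm ≤ diagPart ((π ⊗ₘ K).map (pairExtend d T)) := by
  refine Measure.le_iff.2 fun S hS => ?_
  have hS' := (pathSplit d T).symm.measurable hS
  have hR : MeasurableSet (Prod.fst ⁻¹' S ∩ {z : PathSpace d (T + 1) × PathSpace d (T + 1) |
      z.1 = z.2}) := (measurable_fst hS).inter measurableSet_diag
  have : SFinite (diagPart π) := by unfold diagPart; infer_instance
  rw [Measure.map_apply (pathSplit d T).symm.measurable hS, Measure.compProd_apply hS', diagPart,
    lintegral_map (Kernel.measurable_kernel_prodMk_left hS') measurable_fst, diagPart,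
    Measure.map_apply measurable_fst hS, Measure.restrict_apply (measurable_fst hS),
    Measure.map_apply measurable_pairExtend hR,
    Measure.compProd_apply (measurable_pairExtend hR)]
  refine (setLIntegral_mono' measurableSet_diag fun z hz => ?_).trans
    (setLIntegral_le_lintegral _ _)
  obtain ⟨x, y⟩ := z
  obtain rfl : x = y := hz
  refine le_trans (le_of_eq ?_) (h x _)
  rw [Measure.map_apply (by fun_prop)
    (measurable_prodMk_left (measurable_pairExtend hR))]
  congr 1
  ext e
  simp [pairExtend]

/-- One step of the construction of an almost optimal bicausal coupling. -/
lemma exists_extension (π : Measure (PathSpace d T × PathSpace d T)) [IsProbabilityMeasure π]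
    (h1 : PrefixCausal π Prod.fst Prod.snd) (h2 : PrefixCausal π Prod.snd Prod.fst)
    (κ η : Kernel (PathSpace d T) (Fin d → ℝ)) [IsMarkovKernel κ] [IsMarkovKernel η]
    (r : Measure (PathSpace d T)) [SFinite r] (c : Measure (PathSpace d T × (Fin d → ℝ)))
    (hcκ : c ≤ π.map Prod.fst ⊗ₘ κ) (hcη : c ≤ π.map Prod.snd ⊗ₘ η)
    (hr1 : π.map Prod.fst ≤ diagPart π + r) (hr2 : π.map Prod.snd ≤ diagPart π + r) :
    ∃ π' : Measure (PathSpace d (T + 1) × PathSpace d (T + 1)), IsProbabilityMeasure π' ∧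
      π'.map Prod.fst = (π.map Prod.fst ⊗ₘ κ).map (pathSplit d T).symm ∧
      π'.map Prod.snd = (π.map Prod.snd ⊗ₘ η).map (pathSplit d T).symm ∧
      PrefixCausal π' Prod.fst Prod.snd ∧ PrefixCausal π' Prod.snd Prod.fst ∧
      c.map (pathSplit d T).symm ≤ diagPart π' + (r ⊗ₘ η).map (pathSplit d T).symm := by
  obtain ⟨K, θ, _, _, hKf, hKs, hKd, hθ⟩ := exists_kernel_coupling κ η
  have hθη : ∀ x, θ x ≤ η x := fun x => by
    have h := Measure.map_mono (hKd x) measurable_snd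
    rw [hKs, Measure.map_map measurable_snd (by fun_prop)] at h
    exact (le_of_eq Measure.map_id.symm).trans h
  -- Maximality of `θ` applies because one and the same base measure dominates both marginals.
  have hc : c ≤ (diagPart π + r) ⊗ₘ θ :=
    hθ _ _ (hcκ.trans (compProd_mono hr1 fun _ => le_rfl))
      (hcη.trans (compProd_mono hr2 fun _ => le_rfl))
  have hm := (pathSplit d T).symm.measurable
  refine ⟨(π ⊗ₘ K).map (pairExtend d T),
    Measure.isProbabilityMeasure_map measurable_pairExtend.aemeasurable, ?_, ?_, ?_, ?_, ?_⟩
  · rw [Measure.map_map measurable_fst measurable_pairExtend,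
      ← map_compProd_of_map_eq π K κ measurable_fst measurable_fst hKf,
      Measure.map_map hm (measurable_fst.prodMap measurable_fst)]
    rfl
  · rw [Measure.map_map measurable_snd measurable_pairExtend,
      ← map_compProd_of_map_eq π K η measurable_snd measurable_snd hKs,
      Measure.map_map hm (measurable_snd.prodMap measurable_snd)]
    rfl
  · exact PrefixCausal.map (h1.extend measurable_fst measurable_snd K κ (V := Prod.snd)
      measurable_fst hKf) measurable_pairExtend measurable_fst measurable_snd
  · exact PrefixCausal.map (h2.extend measurable_snd measurable_fst K η (V := Prod.fst)
      measurable_snd hKs) measurable_pairExtend measurable_snd measurable_fst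
  · refine (Measure.map_mono hc hm).trans ?_
    rw [Measure.compProd_add_left, Measure.map_add _ _ hm]
    exact add_le_add (diagPart_compProd_le π K θ hKd)
      (Measure.map_mono (compProd_mono le_rfl hθη) hm)

end

/-! ### Growth of weights and the inductive construction -/

/-- The first `t` time steps of a path. -/
def pathPrefix {d T t : ℕ} (h : t ≤ T) (x : PathSpace d T) : PathSpace d t :=
  fun i => x (Fin.castLE h i)

lemma measurable_pathPrefix {d T t : ℕ} (h : t ≤ T) :
    Measurable (pathPrefix h : PathSpace d T → PathSpace d t) :=
  measurable_pi_lambda _ fun _ => measurable_pi_apply _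

/-- In the step from time `t` to time `t + 1` the conditional expectation of the weight grows at
most by the factor `C t`. -/
def WeightGrowth {d : ℕ} (w : ∀ n, PathSpace d n → ℝ≥0∞) (C : ℕ → ℝ≥0∞) {T : ℕ}
    (ν : Measure (PathSpace d T)) : Prop :=
  ∀ (t : ℕ) (h : t + 1 ≤ T) (A : Set (PathSpace d t)), MeasurableSet A →
    ∫⁻ x in pathPrefix (t.le_succ.trans h) ⁻¹' A, w (t + 1) (pathPrefix h x) ∂ν ≤
      C t * ∫⁻ x in pathPrefix (t.le_succ.trans h) ⁻¹' A,
        w t (pathPrefix (t.le_succ.trans h) x) ∂ν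

/-- The factor in the estimate of the part of `μ ∧ ν` which is not coupled diagonally. -/
noncomputable def growthSum (C : ℕ → ℝ≥0∞) (T : ℕ) : ℝ≥0∞ :=
  ∑ t ∈ Finset.Ico 1 T, ∏ s ∈ Finset.Ico t T, C s

/-- This is the recursion of the remainder. It fails to describe `T = 0`, where the remainder
vanishes and `C 0` does not enter. -/
lemma growthSum_succ (C : ℕ → ℝ≥0∞) {T : ℕ} (hT : 1 ≤ T) :
    growthSum C (T + 1) = C T * (1 + growthSum C T) := by
  unfold growthSum
  rw [Finset.sum_Ico_succ_top hT, Finset.prod_Ico_succ_top le_rfl, Finset.Ico_self,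
    Finset.prod_empty, one_mul, mul_add, mul_one, add_comm, Finset.mul_sum]
  congr 1
  refine Finset.sum_congr rfl fun t ht => ?_
  rw [Finset.prod_Ico_succ_top (Finset.mem_Ico.1 ht).2.le, mul_comm]

section

variable {d : ℕ} {w : ∀ n, PathSpace d n → ℝ≥0∞} {C : ℕ → ℝ≥0∞}

lemma WeightGrowth.init {T : ℕ} {ν : Measure (PathSpace d (T + 1))} (h : WeightGrowth w C ν)
    (hw : ∀ n, Measurable (w n)) : WeightGrowth w C (ν.map Fin.init) := by
  intro t ht A hA
  have hA' := measurable_pathPrefix (t.le_succ.trans ht) hA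
  have h1 : Measurable fun x : PathSpace d T => w (t + 1) (pathPrefix ht x) :=
    (hw _).comp (measurable_pathPrefix _)
  have h2 : Measurable fun x : PathSpace d T => w t (pathPrefix (t.le_succ.trans ht) x) :=
    (hw _).comp (measurable_pathPrefix _)
  rw [setLIntegral_map hA' h1 measurable_init, setLIntegral_map hA' h2 measurable_init]
  exact h t (ht.trans T.le_succ) A hA

/-- A disintegration of `ν` for which the growth bound holds everywhere. -/
lemma WeightGrowth.exists_kernel {T : ℕ} {ν : Measure (PathSpace d (T + 1))} [IsFiniteMeasure ν]
    (h : WeightGrowth w C ν) (hw : ∀ n, Measurable (w n)) (e₀ : Fin d → ℝ)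
    (he : ∀ x, w (T + 1) ((pathSplit d T).symm (x, e₀)) ≤ C T * w T x) :
    ∃ η : Kernel (PathSpace d T) (Fin d → ℝ), IsMarkovKernel η ∧
      ν.map (pathSplit d T) = ν.map Fin.init ⊗ₘ η ∧
      ∀ x, ∫⁻ e, w (T + 1) ((pathSplit d T).symm (x, e)) ∂η x ≤ C T * w T x := by
  classical
  set σ := ν.map (pathSplit d T) with hσ
  have hfst : σ.fst = ν.map Fin.init := by
    rw [Measure.fst, hσ, Measure.map_map measurable_fst (pathSplit d T).measurable]
    rfl
  set η₀ := σ.condKernel with hη₀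
  have hdis : ν.map Fin.init ⊗ₘ η₀ = σ := by
    rw [← hfst]
    exact σ.disintegrate σ.condKernel
  have hwm : Measurable fun z => w (T + 1) ((pathSplit d T).symm z) :=
    (hw _).comp (pathSplit d T).symm.measurable
  have hF : Measurable fun x => ∫⁻ e, w (T + 1) ((pathSplit d T).symm (x, e)) ∂η₀ x :=
    hwm.lintegral_kernel_prod_right'
  have hG : Measurable fun x => C T * w T x := (hw T).const_mul _
  have hae : (fun x => ∫⁻ e, w (T + 1) ((pathSplit d T).symm (x, e)) ∂η₀ x)
      ≤ᵐ[ν.map Fin.init] fun x => C T * w T x := by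
    -- The growth bound on all past events is an almost sure bound on the disintegration.
    refine ae_le_of_forall_setLIntegral_le_of_sigmaFinite hF fun A hA _ => ?_
    rw [lintegral_const_mul _ (hw T), setLIntegral_map hA (hw T) measurable_init]
    refine le_trans (le_of_eq ?_) (h T le_rfl A hA)
    have e1 := Measure.setLIntegral_compProd (μ := ν.map Fin.init) (κ := η₀) hwm hA
      MeasurableSet.univ
    simp only [Measure.restrict_univ] at e1
    rw [← e1, hdis, hσ, setLIntegral_map (hA.prod MeasurableSet.univ) hwm
      (pathSplit d T).measurable, Set.prod_univ]
    simp only [MeasurableEquiv.symm_apply_apply]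
    rfl
  have hs : MeasurableSet {x | ∫⁻ e, w (T + 1) ((pathSplit d T).symm (x, e)) ∂η₀ x ≤ C T * w T x} :=
    measurableSet_le hF hG
  -- The kernel is changed to a Dirac mass at `e₀` on the exceptional null set. A bound everywhere
  -- is needed, since the remainder integrated later may be singular to the law of `ν`.
  refine ⟨Kernel.piecewise hs η₀ (Kernel.const _ (Measure.dirac e₀)), inferInstance, ?_, ?_⟩
  · rw [← hdis]
    refine Measure.compProd_congr ?_
    filter_upwards [hae] with x hx
    rw [Kernel.piecewise_apply, if_pos (by exact hx)]
  · intro x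
    rw [Kernel.lintegral_piecewise]
    split_ifs with hx
    · exact hx
    · rw [Kernel.const_apply, lintegral_dirac' _ (by exact hwm.comp measurable_prodMk_left)]
      exact he x

/-- If `c` is a common part of `μ` and `ν`, then a bicausal coupling of `μ` and `ν` charges the
diagonal by `c` up to a remainder whose weight is controlled by the weights of `μ - c` and
`ν - c`. -/
theorem exists_prefixCausal_coupling (hw : ∀ n, Measurable (w n))
    (hmono : ∀ n z, w n z.1 ≤ w (n + 1) ((pathSplit d n).symm z)) (e₀ : Fin d → ℝ)
    (he : ∀ n x, w (n + 1) ((pathSplit d n).symm (x, e₀)) ≤ C n * w n x) :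
    ∀ (T : ℕ) (μ ν c δ₁ δ₂ : Measure (PathSpace d T)) [IsProbabilityMeasure μ]
      [IsProbabilityMeasure ν], μ = c + δ₁ → ν = c + δ₂ → WeightGrowth w C ν →
      ∃ (π : Measure (PathSpace d T × PathSpace d T)) (r r₀ : Measure (PathSpace d T)),
        IsProbabilityMeasure π ∧ IsFiniteMeasure r ∧
        π.map Prod.fst = μ ∧ π.map Prod.snd = ν ∧
        PrefixCausal π Prod.fst Prod.snd ∧ PrefixCausal π Prod.snd Prod.fst ∧
        μ ≤ diagPart π + r ∧ ν ≤ diagPart π + r ∧ c ≤ diagPart π + r₀ ∧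
        ∫⁻ x, w T x ∂r ≤ (if T = 0 then 0 else 1 + growthSum C T) * ∫⁻ x, w T x ∂(δ₁ + δ₂) ∧
        ∫⁻ x, w T x ∂r₀ ≤ growthSum C T * ∫⁻ x, w T x ∂(δ₁ + δ₂) := by
  intro T
  induction T with
  | zero =>
    intro μ ν c δ₁ δ₂ _ _ hμ hν _
    have hd : {z : PathSpace d 0 × PathSpace d 0 | z.1 = z.2} = Set.univ :=
      Set.eq_univ_of_forall fun z => Subsingleton.elim _ _
    have heq : μ = ν := by
      refine Measure.ext fun S _ => ?_
      rcases S.eq_empty_or_nonempty with rfl | ⟨x, hx⟩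
      · simp
      · have : S = Set.univ := Set.eq_univ_of_forall fun y => Subsingleton.elim x y ▸ hx
        simp [this]
    have hf : (μ.prod ν).map Prod.fst = μ := by simp
    have hs : (μ.prod ν).map Prod.snd = ν := by simp
    have hdiag : diagPart (μ.prod ν) = μ := by
      rw [diagPart, hd, Measure.restrict_univ, hf]
    -- Paths of length zero form one point, so the diagonal carries everything and `r = 0`; hence
    -- the factor `0` for `T = 0`.
    refine ⟨μ.prod ν, 0, 0, inferInstance, inferInstance, hf, hs,
      prefixCausal_zero _ measurable_fst, prefixCausal_zero _ measurable_snd, ?_, ?_, ?_, ?_, ?_⟩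
    · rw [hdiag, add_zero]
    · rw [hdiag, add_zero, heq]
    · rw [hdiag, add_zero, hμ]
      exact Measure.le_add_right le_rfl
    · simp
    · simp
  | succ T ih =>
    intro μ ν c δ₁ δ₂ _ _ hμ hν hgr
    have hi := measurable_init (d := d) (T := T)
    have hsp := (pathSplit d T).measurable
    have hsm := (pathSplit d T).symm.measurable
    have hμi : IsProbabilityMeasure (μ.map (Fin.init : PathSpace d (T + 1) → PathSpace d T)) :=
      Measure.isProbabilityMeasure_map hi.aemeasurable
    have hνi : IsProbabilityMeasure (ν.map (Fin.init : PathSpace d (T + 1) → PathSpace d T)) :=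
      Measure.isProbabilityMeasure_map hi.aemeasurable
    have : IsFiniteMeasure δ₁ := isFiniteMeasure_of_le μ (hμ ▸ Measure.le_add_left le_rfl)
    have : IsFiniteMeasure δ₂ := isFiniteMeasure_of_le ν (hν ▸ Measure.le_add_left le_rfl)
    obtain ⟨π, r, r₀, _, _, hπf, hπs, hp1, hp2, hr1, hr2, -, hr, -⟩ :=
      ih (μ.map Fin.init) (ν.map Fin.init) (c.map Fin.init) (δ₁.map Fin.init) (δ₂.map Fin.init)
        (by rw [hμ, Measure.map_add _ _ hi]) (by rw [hν, Measure.map_add _ _ hi]) (hgr.init hw)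
    obtain ⟨η, _, hη, hηw⟩ := hgr.exists_kernel hw e₀ (he T)
    obtain ⟨κ, _, hκ⟩ : ∃ κ : Kernel (PathSpace d T) (Fin d → ℝ), IsMarkovKernel κ ∧
        μ.map (pathSplit d T) = μ.map Fin.init ⊗ₘ κ := by
      refine ⟨(μ.map (pathSplit d T)).condKernel, inferInstance, ?_⟩
      have hfst : (μ.map (pathSplit d T)).fst = μ.map Fin.init := by
        rw [Measure.fst, Measure.map_map measurable_fst hsp]
        rfl
      rw [← hfst]
      exact ((μ.map (pathSplit d T)).disintegrate _).symm
    have hback : ∀ m : Measure (PathSpace d (T + 1)),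
        (m.map (pathSplit d T)).map (pathSplit d T).symm = m := fun m => by
      rw [Measure.map_map hsm hsp, MeasurableEquiv.symm_comp_self, Measure.map_id]
    have hcμ : c ≤ μ := hμ ▸ Measure.le_add_right le_rfl
    have hcν : c ≤ ν := hν ▸ Measure.le_add_right le_rfl
    obtain ⟨π', _, hf', hs', hp1', hp2', hc'⟩ := exists_extension π hp1 hp2 κ η r
      (c.map (pathSplit d T)) (by rw [hπf, ← hκ]; exact Measure.map_mono hcμ hsp)
      (by rw [hπs, ← hη]; exact Measure.map_mono hcν hsp)
      (by rw [hπf]; exact hr1) (by rw [hπs]; exact hr2)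
    rw [hπf, ← hκ, hback] at hf'
    rw [hπs, ← hη, hback] at hs'
    rw [hback] at hc'
    have hinit : ∫⁻ x, w T x ∂(δ₁.map Fin.init + δ₂.map Fin.init) ≤
        ∫⁻ x, w (T + 1) x ∂(δ₁ + δ₂) := by
      rw [← Measure.map_add _ _ hi, lintegral_map (hw T) hi]
      refine lintegral_mono fun x => ?_
      have := hmono T (pathSplit d T x)
      rwa [MeasurableEquiv.symm_apply_apply] at this
    have hr₀ : ∫⁻ x, w (T + 1) x ∂((r ⊗ₘ η).map (pathSplit d T).symm) ≤
        growthSum C (T + 1) * ∫⁻ x, w (T + 1) x ∂(δ₁ + δ₂) := by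
      rw [lintegral_map (hw _) hsm, Measure.lintegral_compProd (by exact (hw _).comp hsm)]
      refine (lintegral_mono hηw).trans ?_
      rw [lintegral_const_mul _ (hw T)]
      refine (mul_le_mul_right (hr.trans (mul_le_mul_right hinit _)) _).trans ?_
      rw [← mul_assoc]
      refine mul_le_mul_left ?_ _
      rcases Nat.eq_zero_or_pos T with rfl | hT
      · simp
      · rw [if_neg hT.ne', growthSum_succ C hT]
    -- Adding both `δ₁` and `δ₂` makes one measure serve for `μ` and `ν`.
    refine ⟨π', (δ₁ + δ₂) + (r ⊗ₘ η).map (pathSplit d T).symm,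
      (r ⊗ₘ η).map (pathSplit d T).symm, ‹_›, inferInstance, hf', hs', hp1', hp2', ?_, ?_, hc',
      ?_, hr₀⟩
    · rw [hμ, add_left_comm, add_comm c]
      exact add_le_add (Measure.le_add_right le_rfl) hc'
    · rw [hν, add_left_comm, add_comm c]
      exact add_le_add (Measure.le_add_left le_rfl) hc'
    · rw [lintegral_add_measure, if_neg (Nat.succ_ne_zero T), add_mul, one_mul]
      exact add_le_add le_rfl hr₀

end

/-! ### From densities to bicausality -/

/-- The density `k`, evaluated along `X`, is measurable for the smaller σ-algebra and has the right
integrals over all events of the larger one, so it is a version of both conditional probabilities.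
-/
lemma PrefixCausal.condExp_eq {d T : ℕ} {Ω : Type*} [MeasurableSpace Ω] {ρ : Measure Ω}
    [IsFiniteMeasure ρ] {X Y : Ω → PathSpace d T} (h : PrefixCausal ρ X Y) (hX : Measurable X)
    (hY : Measurable Y) {n : ℕ} {B : Set (PathSpace d T)} (hB : MeasurableSet[pathSigma d T n] B) :
    ρ⟦Y ⁻¹' B | MeasurableSpace.comap X inferInstance⟧
      =ᵐ[ρ] ρ⟦Y ⁻¹' B | MeasurableSpace.comap X (pathSigma d T n)⟧ := by
  obtain ⟨k, hk, e⟩ := h n B hB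
  have hk' : Measurable k := hk.mono (pathSigma_le _ _ _) le_rfl
  have hS : MeasurableSet (Y ⁻¹' B) := hY (pathSigma_le _ _ _ _ hB)
  have hset : ∀ A, MeasurableSet A → ∫⁻ ω in X ⁻¹' A, k (X ω) ∂ρ = ρ (X ⁻¹' A ∩ Y ⁻¹' B) := by
    intro A hA
    rw [← setLIntegral_map hA hk' hX, ← withDensity_apply _ hA, ← e, Measure.map_apply hX hA,
      Measure.restrict_apply (hX hA)]
  have hfin : ∫⁻ ω, k (X ω) ∂ρ ≠ ∞ := by
    have := hset Set.univ MeasurableSet.univ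
    rw [Set.preimage_univ, Measure.restrict_univ] at this
    rw [this]
    exact measure_ne_top _ _
  have hkX : Measurable fun ω => k (X ω) := hk'.comp hX
  have hint : Integrable (fun ω => (k (X ω)).toReal) ρ :=
    integrable_toReal_of_lintegral_ne_top hkX.aemeasurable hfin
  have key : ∀ m' : MeasurableSpace (PathSpace d T), pathSigma d T n ≤ m' →
      m' ≤ MeasurableSpace.pi → (fun ω => (k (X ω)).toReal)
        =ᵐ[ρ] ρ⟦Y ⁻¹' B | MeasurableSpace.comap X m'⟧ := by
    intro m' h1 h2
    have hle : MeasurableSpace.comap X m' ≤ ‹MeasurableSpace Ω› :=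
      (MeasurableSpace.comap_mono h2).trans hX.comap_le
    refine ae_eq_condExp_of_forall_setIntegral_eq hle
      ((integrable_const (1 : ℝ)).indicator hS) (fun _ _ _ => hint.integrableOn) ?_ ?_
    · rintro _ ⟨A, hA, rfl⟩ _
      rw [integral_toReal hkX.aemeasurable.restrict
        (ae_restrict_of_ae (ae_lt_top hkX hfin)), hset A (h2 _ hA),
        integral_indicator hS, setIntegral_const, smul_eq_mul, mul_one, measureReal_def,
        Measure.restrict_apply hS, Set.inter_comm]
    · refine Measurable.aestronglyMeasurable (m := MeasurableSpace.comap X m') ?_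
      exact ENNReal.measurable_toReal.comp
        ((hk.mono h1 le_rfl).comp (comap_measurable (m := m') X))
  exact (key _ (pathSigma_le _ _ _) le_rfl).symm.trans (key _ le_rfl (pathSigma_le _ _ _))

lemma isBicausal_of_prefixCausal {d T : ℕ} {π : Measure (PathSpace d T × PathSpace d T)}
    [IsFiniteMeasure π] {μ ν : Measure (PathSpace d T)} (hf : π.map Prod.fst = μ)
    (hs : π.map Prod.snd = ν) (h1 : PrefixCausal π Prod.fst Prod.snd)
    (h2 : PrefixCausal π Prod.snd Prod.fst) : IsBicausal π μ ν where
  coupling := ⟨hf, hs⟩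
  causal _ _ _ _ hB := h1.condExp_eq measurable_fst measurable_snd hB
  anticausal _ _ _ _ hB := h2.condExp_eq measurable_snd measurable_fst hB

/-! ### Decompositions and off-diagonal cost -/

/-- The cost of a coupling splits into the off-diagonal cost and the weight of the diagonal. -/
lemma lintegral_offDiag_add {A : Type*} [MeasurableSpace A] [StandardBorelSpace A]
    (π : Measure (A × A)) {w : A → ℝ≥0∞} (hw : Measurable w) :
    ∫⁻ z in {z | z.1 ≠ z.2}, (w z.1 + w z.2) ∂π + 2 * ∫⁻ x, w x ∂(diagPart π) =
      ∫⁻ x, w x ∂(π.map Prod.fst) + ∫⁻ x, w x ∂(π.map Prod.snd) := by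
  have hw1 : Measurable fun z : A × A => w z.1 := hw.comp measurable_fst
  rw [lintegral_map hw measurable_fst, lintegral_map hw measurable_snd,
    ← lintegral_add_left hw1, diagPart, lintegral_map hw measurable_fst,
    ← lintegral_const_mul _ hw1]
  have h : ∫⁻ z in {z | z.1 = z.2}, 2 * w z.1 ∂π = ∫⁻ z in {z | z.1 = z.2}, (w z.1 + w z.2) ∂π := by
    refine setLIntegral_congr_fun (measurableSet_diag (A := A)) fun z hz => ?_
    rw [← show z.1 = z.2 from hz, two_mul]
  rw [h, add_comm]
  exact lintegral_add_compl _ measurableSet_diag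

/-- A coupling decomposes both marginals into the diagonal part and a rest. -/
lemma exists_decomposition_of_isCoupling {d T : ℕ} {π : Measure (PathSpace d T × PathSpace d T)}
    {μ ν : Measure (PathSpace d T)} (h : IsCoupling π μ ν) :
    ∃ δ₁ δ₂ : Measure (PathSpace d T), μ = diagPart π + δ₁ ∧ ν = diagPart π + δ₂ ∧
      ∀ w : PathSpace d T → ℝ≥0∞, Measurable w →
        ∫⁻ x, w x ∂(δ₁ + δ₂) = ∫⁻ z in {z | z.1 ≠ z.2}, (w z.1 + w z.2) ∂π := by
  have hsplit := Measure.restrict_add_restrict_compl (μ := π)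
    (measurableSet_diag (A := PathSpace d T))
  refine ⟨(π.restrict {z | z.1 = z.2}ᶜ).map Prod.fst, (π.restrict {z | z.1 = z.2}ᶜ).map Prod.snd,
    ?_, ?_, fun w hw => ?_⟩
  · rw [diagPart, ← Measure.map_add _ _ measurable_fst, hsplit, h.1]
  · have : diagPart π = (π.restrict {z | z.1 = z.2}).map Prod.snd := by
      refine Measure.map_congr ?_
      filter_upwards [ae_restrict_mem measurableSet_diag] with z hz using hz
    rw [this, ← Measure.map_add _ _ measurable_snd, hsplit, h.2]
  · have hw1 : Measurable fun z : PathSpace d T × PathSpace d T => w z.1 := hw.comp measurable_fst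
    rw [lintegral_add_measure, lintegral_map hw measurable_fst, lintegral_map hw measurable_snd,
      ← lintegral_add_left hw1]
    rfl

/-- The Jordan decomposition of `μ - ν` gives the largest common part of `μ` and `ν`. -/
lemma exists_minimal_decomposition {d T : ℕ} (μ ν : Measure (PathSpace d T)) [IsFiniteMeasure μ]
    [IsFiniteMeasure ν] :
    ∃ c p q : Measure (PathSpace d T), μ = c + p ∧ ν = c + q ∧ (p + q) Set.univ = tv μ ν ∧
      ∀ c' δ₁ δ₂ : Measure (PathSpace d T), μ = c' + δ₁ → ν = c' + δ₂ → p + q ≤ δ₁ + δ₂ := by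
  set j := (μ.toSignedMeasure - ν.toSignedMeasure).toJordanDecomposition with hj
  set p := j.posPart with hp
  set q := j.negPart with hq
  have hsum : μ + q = ν + p := by
    have h1 : p.toSignedMeasure - q.toSignedMeasure = μ.toSignedMeasure - ν.toSignedMeasure :=
      SignedMeasure.toSignedMeasure_toJordanDecomposition _
    rw [← Measure.toSignedMeasure_eq_toSignedMeasure_iff, Measure.toSignedMeasure_add,
      Measure.toSignedMeasure_add]
    rw [sub_eq_sub_iff_add_eq_add] at h1
    rw [← h1, add_comm]
  obtain ⟨S, hS, hpS, hqS⟩ := j.mutuallySingular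
  -- On `Rᶜ`, which carries `p'`, the measure `q'` vanishes, so `c' + δ = m + p' ≥ c' + p'` there,
  -- and the finite `c'` cancels.
  have bound : ∀ (p' q' δ δ' m c' : Measure (PathSpace d T)) (R : Set (PathSpace d T))
      [IsFiniteMeasure m], MeasurableSet R → c' + δ + q' = m + p' → m = c' + δ' → p' R = 0 →
      q' Rᶜ = 0 → p' ≤ δ := by
    intro p' q' δ δ' m c' R _ hR h1 h2 hpR hqR
    refine Measure.le_iff.2 fun A hA => ?_
    have e1 : p' A = p' (A ∩ Rᶜ) := by
      rw [← measure_inter_add_sdiff A hR, measure_mono_null Set.inter_subset_right hpR, zero_add]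
      rfl
    have e2 := congrArg (fun l : Measure _ => l (A ∩ Rᶜ)) h1
    have hc' : c' (A ∩ Rᶜ) ≠ ∞ := by
      refine ne_top_of_le_ne_top (measure_ne_top m (A ∩ Rᶜ)) ?_
      rw [h2, Measure.add_apply]
      exact le_self_add
    simp only [Measure.add_apply, measure_mono_null Set.inter_subset_right hqR, add_zero] at e2
    rw [e1]
    refine le_trans ?_ (measure_mono (μ := δ) (Set.inter_subset_left : A ∩ Rᶜ ⊆ A))
    refine (ENNReal.add_le_add_iff_left hc').1 ?_
    rw [e2]
    refine add_le_add ?_ le_rfl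
    rw [h2, Measure.add_apply]
    exact le_self_add
  have hmin : ∀ c' δ₁ δ₂ : Measure (PathSpace d T), μ = c' + δ₁ → ν = c' + δ₂ →
      p ≤ δ₁ ∧ q ≤ δ₂ := by
    intro c' δ₁ δ₂ h1 h2
    refine ⟨bound p q δ₁ δ₂ ν c' S hS (by rw [← h1, hsum]) h2 hpS hqS,
      bound q p δ₂ δ₁ μ c' Sᶜ hS.compl (by rw [← h2, hsum]) h1 hqS (by rwa [compl_compl])⟩
  -- Minimality against the decomposition with zero common part makes `μ - p` a true difference.
  have hpμ : p ≤ μ := (hmin 0 μ ν (zero_add _).symm (zero_add _).symm).1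
  have hμ : μ = (μ - p) + p := (Measure.sub_add_cancel_of_le hpμ).symm
  refine ⟨μ - p, p, q, hμ, ?_, rfl, fun c' δ₁ δ₂ h1 h2 => ?_⟩
  · have : (μ - p) + q + p = ν + p := by rw [add_right_comm, ← hμ, hsum]
    refine Measure.ext fun A _ => ?_
    have := congrArg (fun l : Measure _ => l A) this
    simp only [Measure.add_apply] at this ⊢
    exact ((ENNReal.add_left_inj (measure_ne_top p A)).1 this).symm
  · exact add_le_add (hmin c' δ₁ δ₂ h1 h2).1 (hmin c' δ₁ δ₂ h1 h2).2

/-- The adapted total variation is bounded by the weight of any decomposition into a common part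
and remainders. -/
lemma weightedATV_le_of_decomposition {d T : ℕ} {W : ∀ n, PathSpace d n → ℝ≥0} {C : ℕ → ℝ≥0∞}
    (hW : ∀ n, Measurable (W n))
    (hmono : ∀ n z, W n z.1 ≤ W (n + 1) ((pathSplit d n).symm z)) (e₀ : Fin d → ℝ)
    (he : ∀ n x, (W (n + 1) ((pathSplit d n).symm (x, e₀)) : ℝ≥0∞) ≤ C n * W n x)
    {μ ν c δ₁ δ₂ : Measure (PathSpace d T)} [IsProbabilityMeasure μ] [IsProbabilityMeasure ν]
    (hμ : μ = c + δ₁) (hν : ν = c + δ₂) (hgr : WeightGrowth (fun n x => (W n x : ℝ≥0∞)) C ν)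
    (hfin : ∫⁻ x, W T x ∂μ ≠ ∞) :
    weightedATV (W T) μ ν ≤ (1 + 2 * growthSum C T) * ∫⁻ x, W T x ∂(δ₁ + δ₂) := by
  have hw : ∀ n, Measurable fun x => (W n x : ℝ≥0∞) := fun n => (hW n).coe_nnreal_ennreal
  obtain ⟨π, r, r₀, _, _, hf, hs, hp1, hp2, -, -, hc, -, hr₀⟩ :=
    exists_prefixCausal_coupling (w := fun n x => (W n x : ℝ≥0∞)) hw
      (fun n z => ENNReal.coe_le_coe.2 (hmono n z)) e₀ he T μ ν c δ₁ δ₂ hμ hν hgr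
  refine (iInf₂_le π (isBicausal_of_prefixCausal hf hs hp1 hp2)).trans ?_
  simp only [ENNReal.coe_add]
  have hsplit := lintegral_offDiag_add π (hw T)
  have hdfin : 2 * ∫⁻ x, W T x ∂(diagPart π) ≠ ∞ := by
    refine ENNReal.mul_ne_top (by simp) (ne_top_of_le_ne_top hfin ?_)
    rw [← hf]
    exact lintegral_mono' (Measure.map_mono Measure.restrict_le_self measurable_fst) le_rfl
  -- The diagonal weight is finite, so it may be added to both sides in place of a subtraction.
  refine (ENNReal.add_le_add_iff_right hdfin).1 ?_
  rw [hsplit, hf, hs]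
  have hcle := lintegral_mono' hc (le_refl fun x => (W T x : ℝ≥0∞))
  rw [lintegral_add_measure] at hcle
  calc ∫⁻ x, W T x ∂μ + ∫⁻ x, W T x ∂ν
      = ∫⁻ x, W T x ∂(δ₁ + δ₂) + 2 * ∫⁻ x, W T x ∂c := by
        rw [hμ, hν]
        simp only [lintegral_add_measure]
        ring
    _ ≤ ∫⁻ x, W T x ∂(δ₁ + δ₂) + 2 * (∫⁻ x, W T x ∂(diagPart π) +
        growthSum C T * ∫⁻ x, W T x ∂(δ₁ + δ₂)) := by
        gcongr
        exact hcle.trans (add_le_add le_rfl hr₀)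
    _ = _ := by ring

/-! ### The weights `1 + |x|_p^p` and their growth under `ν` -/

section Weights

variable {d T : ℕ} {p : ℝ}

lemma measurable_statePow (p : ℝ) : Measurable (statePow p : (Fin d → ℝ) → ℝ≥0) := by
  unfold statePow
  fun_prop

lemma measurable_pathPow (p : ℝ) : Measurable (pathPow p : PathSpace d T → ℝ≥0) :=
  Finset.measurable_fun_sum _ fun t _ => (measurable_statePow p).comp (measurable_pi_apply t)

lemma pathPow_pathSplit_symm (p : ℝ) (z : PathSpace d T × (Fin d → ℝ)) :
    pathPow p ((pathSplit d T).symm z) = pathPow p z.1 + statePow p z.2 := by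
  simp [pathPow, Fin.sum_univ_castSucc, pathSplit_symm_apply]

lemma statePow_zero (hp : p ≠ 0) : statePow p (0 : Fin d → ℝ) = 0 := by
  simp [statePow, NNReal.zero_rpow hp]

lemma statePow_sub_le (hp : 1 ≤ p) (v v' : Fin d → ℝ) :
    statePow p (v - v') ≤ 2 ^ (p - 1) * (statePow p v + statePow p v') := by
  unfold statePow
  rw [← Finset.sum_add_distrib, Finset.mul_sum]
  refine Finset.sum_le_sum fun k _ => ?_
  exact (NNReal.rpow_le_rpow (nnnorm_sub_le _ _) (by linarith)).trans
    (NNReal.rpow_add_le_mul_rpow_add_rpow _ _ hp)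

lemma pathPow_sub_le (hp : 1 ≤ p) (x y : PathSpace d T) :
    pathPow p (x - y) ≤ 2 ^ (p - 1) * (pathPow p x + pathPow p y) := by
  unfold pathPow
  rw [← Finset.sum_add_distrib, Finset.mul_sum]
  exact Finset.sum_le_sum fun t _ => statePow_sub_le hp _ _

lemma pathPow_zero (hp : p ≠ 0) : pathPow p (0 : PathSpace d T) = 0 :=
  Finset.sum_eq_zero fun _ _ => statePow_zero hp

lemma pathPow_sub_le_two_rpow (hp : 1 ≤ p) (x y : PathSpace d T) :
    (pathPow p (x - y) : ℝ≥0∞) ≤ 2 ^ p * (((1 + pathPow p x) + (1 + pathPow p y) : ℝ≥0) : ℝ≥0∞) := by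
  have h2 : (2 : ℝ≥0∞) ^ p = ((2 ^ p : ℝ≥0) : ℝ≥0∞) := by
    rw [ENNReal.coe_rpow_of_nonneg _ (by linarith)]
    rfl
  rw [h2, ← ENNReal.coe_mul, ENNReal.coe_le_coe]
  refine (pathPow_sub_le hp x y).trans (mul_le_mul' ?_ ?_)
  · exact NNReal.rpow_le_rpow_of_exponent_le (by norm_num) (by linarith)
  · exact add_le_add le_add_self le_add_self

lemma pathPow_pathPrefix (p : ℝ) {t : Fin T} (x : PathSpace d T) :
    ∑ s ∈ Finset.univ.filter (fun s : Fin T => s < t), statePow p (x s) =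
      pathPow p (pathPrefix t.2.le x) := by
  symm
  unfold pathPow pathPrefix
  refine Finset.sum_bij (fun i _ => Fin.castLE t.2.le i) (fun i _ => ?_) (fun i _ j _ h => ?_)
    (fun s hs => ?_) (fun i _ => rfl)
  · exact Finset.mem_filter.2 ⟨Finset.mem_univ _, Fin.lt_def.2 i.2⟩
  · exact Fin.castLE_injective t.2.le h
  · have : s.val < t.val := Fin.lt_def.1 (Finset.mem_filter.1 hs).2
    exact ⟨⟨s.val, this⟩, Finset.mem_univ _, rfl⟩

lemma measurable_pathPrefix_pathSigma {t : ℕ} (h : t ≤ T) :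
    Measurable[pathSigma d T t] (pathPrefix h : PathSpace d T → PathSpace d t) :=
  @measurable_pi_lambda _ _ _ (pathSigma d T t) _ _ fun i => measurable_coord (Fin.castLE h i) i.2

/-- `momentConst` bounds the `p`-th moment of the next step on every event of the past. -/
lemma setLIntegral_statePow_le {ν : Measure (PathSpace d T)} [IsProbabilityMeasure ν]
    (hν : HasFiniteMoment p ν) (t : Fin T) {A : Set (PathSpace d t)} (hA : MeasurableSet A) :
    ∫⁻ x in pathPrefix t.2.le ⁻¹' A, statePow p (x t) ∂ν ≤
      momentConst p ν t * ∫⁻ x in pathPrefix t.2.le ⁻¹' A,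
        (1 + pathPow p (pathPrefix t.2.le x) : ℝ≥0) ∂ν := by
  have hm : pathSigma d T t.val ≤ MeasurableSpace.pi := pathSigma_le d T t
  set S := pathPrefix (d := d) t.2.le ⁻¹' A with hSdef
  have hS : MeasurableSet[pathSigma d T t.val] S := measurable_pathPrefix_pathSigma t.2.le hA
  have hmeas : Measurable fun x : PathSpace d T => statePow p (x t) :=
    (measurable_statePow p).comp (measurable_pi_apply t)
  have hint : Integrable (fun x : PathSpace d T => (statePow p (x t) : ℝ)) ν := by
    refine hν.mono' hmeas.coe_nnreal_real.aestronglyMeasurable (Filter.Eventually.of_forall ?_)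
    intro x
    rw [Real.norm_of_nonneg NNReal.zero_le_coe, NNReal.coe_le_coe]
    exact Finset.single_le_sum (f := fun s => statePow p (x s)) (fun _ _ => zero_le)
      (Finset.mem_univ t)
  set ce := ν[fun x' : PathSpace d T => (statePow p (x' t) : ℝ) | pathSigma d T t.val] with hce
  have hce0 : 0 ≤ᵐ[ν] ce :=
    condExp_nonneg (Filter.Eventually.of_forall fun x => NNReal.zero_le_coe)
  -- `S` belongs to the past, so the next moment may be replaced by its conditional expectation.
  have e1 : ∫⁻ x in S, statePow p (x t) ∂ν = ∫⁻ x in S, ENNReal.ofReal (ce x) ∂ν := by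
    rw [← ofReal_integral_eq_lintegral_ofReal integrable_condExp.integrableOn
      (ae_restrict_of_ae hce0), setIntegral_condExp hm hint hS,
      ofReal_integral_eq_lintegral_ofReal hint.integrableOn
        (Filter.Eventually.of_forall fun x => NNReal.zero_le_coe)]
    simp only [ENNReal.ofReal_coe_nnreal]
  have hwm : Measurable fun x : PathSpace d T =>
      ((1 + pathPow p (pathPrefix t.2.le x) : ℝ≥0) : ℝ≥0∞) :=
    (((measurable_pathPow p).comp (measurable_pathPrefix _)).const_add 1).coe_nnreal_ennreal
  rw [e1, ← lintegral_const_mul _ hwm]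
  refine lintegral_mono_ae (ae_restrict_of_ae ?_)
  have hess := ENNReal.ae_le_essSup (μ := ν) fun x => ENNReal.ofReal (ce x /
    (1 + ∑ s ∈ Finset.univ.filter (fun s : Fin T => s < t), (statePow p (x s) : ℝ)))
  filter_upwards [hess] with x hx
  have hW : (1 + ∑ s ∈ Finset.univ.filter (fun s : Fin T => s < t), (statePow p (x s) : ℝ)) =
      ((1 + pathPow p (pathPrefix t.2.le x) : ℝ≥0) : ℝ) := by
    rw [← pathPow_pathPrefix]
    push_cast
    rfl
  rw [hW] at hx
  have hpos : (0 : ℝ) < ((1 + pathPow p (pathPrefix t.2.le x) : ℝ≥0) : ℝ) := by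
    rw [NNReal.coe_pos]
    exact lt_of_lt_of_le one_pos le_self_add
  calc ENNReal.ofReal (ce x)
      = ENNReal.ofReal (ce x / ((1 + pathPow p (pathPrefix t.2.le x) : ℝ≥0) : ℝ)) *
          ((1 + pathPow p (pathPrefix t.2.le x) : ℝ≥0) : ℝ≥0∞) := by
        rw [← ENNReal.ofReal_coe_nnreal (p := 1 + pathPow p (pathPrefix t.2.le x)),
          ← ENNReal.ofReal_mul' hpos.le, div_mul_cancel₀ _ hpos.ne']
    _ ≤ _ := mul_le_mul_left hx _

/-- The growth factors of the weights `1 + |x|_p^p` under `ν`. -/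
noncomputable def momentFactor (p : ℝ) (ν : Measure (PathSpace d T)) (s : ℕ) : ℝ≥0∞ :=
  if h : s < T then 1 + momentConst p ν ⟨s, h⟩ else 1

/-- Extending a path by the value zero keeps its weight; a factor at least one, also beyond the
horizon, admits this extension as the default. -/
lemma one_le_momentFactor (ν : Measure (PathSpace d T)) (s : ℕ) : 1 ≤ momentFactor p ν s := by
  unfold momentFactor
  split_ifs
  · exact le_self_add
  · exact le_rfl

lemma weightGrowth_momentFactor {ν : Measure (PathSpace d T)} [IsProbabilityMeasure ν]
    (hν : HasFiniteMoment p ν) :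
    WeightGrowth (fun _ x => ((1 + pathPow p x : ℝ≥0) : ℝ≥0∞)) (momentFactor p ν) ν := by
  intro t ht A hA
  have h := setLIntegral_statePow_le hν ⟨t, ht⟩ hA
  have hsucc : ∀ x : PathSpace d T, pathPow p (pathPrefix ht x) =
      pathPow p (pathPrefix (t.le_succ.trans ht) x) + statePow p (x ⟨t, ht⟩) := by
    intro x
    unfold pathPow
    rw [Fin.sum_univ_castSucc]
    rfl
  have hwm : Measurable fun x : PathSpace d T =>
      ((1 + pathPow p (pathPrefix (t.le_succ.trans ht) x) : ℝ≥0) : ℝ≥0∞) :=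
    (((measurable_pathPow p).comp (measurable_pathPrefix _)).const_add 1).coe_nnreal_ennreal
  simp only [hsucc]
  simp only [← add_assoc]
  simp only [ENNReal.coe_add (_ + _) (statePow _ _)]
  rw [lintegral_add_left hwm, momentFactor, dif_pos (show t < T from ht), add_mul, one_mul]
  exact add_le_add le_rfl h

/-- Indices in `Fin T` count from zero, so `t ≤ s.val` means the times `t + 1, …, T`. -/
lemma growthSum_momentFactor (ν : Measure (PathSpace d T)) :
    growthSum (momentFactor p ν) T = ∑ t ∈ Finset.Icc 1 (T - 1),
      ∏ s ∈ Finset.univ.filter (fun s : Fin T => t ≤ s.val), (1 + momentConst p ν s) := by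
  unfold growthSum
  refine Finset.sum_congr ?_ fun t _ => ?_
  · ext t
    simp only [Finset.mem_Ico, Finset.mem_Icc]
    omega
  · symm
    refine Finset.prod_bij (fun s _ => s.val) (fun s hs => ?_) (fun s _ s' _ h => Fin.ext h)
      (fun s hs => ?_) (fun s _ => ?_)
    · exact Finset.mem_Ico.2 ⟨(Finset.mem_filter.1 hs).2, s.2⟩
    · obtain ⟨h1, h2⟩ := Finset.mem_Ico.1 hs
      exact ⟨⟨s, h2⟩, Finset.mem_filter.2 ⟨Finset.mem_univ _, h1⟩, rfl⟩
    · rw [momentFactor, dif_pos s.2]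

end Weights

/-! ### Comparison of the distances -/

section Comparison

variable {d T : ℕ} {p : ℝ} {μ ν : Measure (PathSpace d T)}

/-- The minimal decomposition has at most the weight of any coupling off the diagonal. -/
lemma lintegral_le_weightedTV {δ₁ δ₂ : Measure (PathSpace d T)}
    (hmin : ∀ c' δ₁' δ₂' : Measure (PathSpace d T), μ = c' + δ₁' → ν = c' + δ₂' →
      δ₁ + δ₂ ≤ δ₁' + δ₂') {W : PathSpace d T → ℝ≥0} (hW : Measurable W) :
    ∫⁻ x, W x ∂(δ₁ + δ₂) ≤ weightedTV W μ ν := by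
  refine le_iInf₂ fun π hπ => ?_
  obtain ⟨δ₁', δ₂', h1, h2, h3⟩ := exists_decomposition_of_isCoupling hπ
  simp only [ENNReal.coe_add]
  rw [← h3 _ hW.coe_nnreal_ennreal]
  exact lintegral_mono' (hmin _ _ _ h1 h2) le_rfl

theorem weightedATV_le_weightedTV [IsProbabilityMeasure μ] [IsProbabilityMeasure ν] (hp : p ≠ 0)
    (hμ : HasFiniteMoment p μ) (hν : HasFiniteMoment p ν) :
    weightedATV (fun x => 1 + pathPow p x) μ ν ≤ (1 + 2 * growthSum (momentFactor p ν) T) *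
      weightedTV (fun x => 1 + pathPow p x) μ ν := by
  obtain ⟨c, δ₁, δ₂, h1, h2, -, hmin⟩ := exists_minimal_decomposition μ ν
  have hW : ∀ n, Measurable fun x : PathSpace d n => 1 + pathPow p x :=
    fun n => (measurable_pathPow p).const_add 1
  refine (weightedATV_le_of_decomposition (W := fun n x => 1 + pathPow p x) hW (fun _ z => ?_) 0
    (fun n x => ?_) h1 h2 (weightGrowth_momentFactor hν) ?_).trans
    (mul_le_mul_right (lintegral_le_weightedTV hmin (hW T)) _)
  · rw [pathPow_pathSplit_symm]
    exact add_le_add le_rfl le_self_add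
  · rw [pathPow_pathSplit_symm, statePow_zero hp, add_zero]
    exact le_mul_of_one_le_left' (one_le_momentFactor ν n)
  · have h : ∫⁻ x, (pathPow p x : ℝ≥0∞) ∂μ ≠ ∞ := by
      have := hμ.lintegral_lt_top.ne
      simpa only [ENNReal.ofReal_coe_nnreal] using this
    simp only [ENNReal.coe_add, ENNReal.coe_one]
    rw [lintegral_add_left measurable_const]
    simp [h]

/-- For constant weight all growth factors are one, the growth sum is `T - 1`, and `1 + 2 (T - 1) =
2 T - 1`. -/
theorem atv_le_tv [IsProbabilityMeasure μ] [IsProbabilityMeasure ν] (hT : 1 ≤ T) :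
    atv μ ν ≤ (2 * (T : ℝ≥0∞) - 1) * tv μ ν := by
  obtain ⟨c, δ₁, δ₂, h1, h2, htv, -⟩ := exists_minimal_decomposition μ ν
  have h := weightedATV_le_of_decomposition (W := fun n (_ : PathSpace d n) => 1)
    (C := fun _ => 1) (fun n => measurable_const) (fun _ _ => le_rfl) 0
    (fun n x => by simp) h1 h2 (fun t ht A hA => by simp) (by simp)
  have hg : growthSum (fun _ => 1) T = ((T - 1 : ℕ) : ℝ≥0∞) := by simp [growthSum]
  have hc : (1 + 2 * ((T - 1 : ℕ) : ℝ≥0∞)) = 2 * (T : ℝ≥0∞) - 1 := by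
    refine ENNReal.eq_sub_of_add_eq (by simp) ?_
    obtain ⟨k, rfl⟩ : ∃ k, T = k + 1 := ⟨T - 1, by omega⟩
    push_cast [Nat.add_sub_cancel]
    ring
  rw [hg, hc] at h
  simpa [htv, atv] using h

lemma adaptedWasserstein_rpow (hp : p ≠ 0) : adaptedWasserstein p μ ν ^ p =
    ⨅ (π : Measure (PathSpace d T × PathSpace d T)) (_ : IsBicausal π μ ν),
      ∫⁻ z, (pathPow p (z.1 - z.2) : ℝ≥0∞) ∂π := by
  rw [adaptedWasserstein, one_div, ENNReal.rpow_inv_rpow hp]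

/-- A pointwise bound of the cost off the diagonal. -/
lemma lintegral_pathPow_sub_le (hp : p ≠ 0) {π : Measure (PathSpace d T × PathSpace d T)}
    {W : PathSpace d T → ℝ≥0} (hW : Measurable W) {D : ℝ≥0∞}
    (h : ∀ᵐ z ∂π, (pathPow p (z.1 - z.2) : ℝ≥0∞) ≤ D * ((W z.1 + W z.2 : ℝ≥0) : ℝ≥0∞)) :
    ∫⁻ z, (pathPow p (z.1 - z.2) : ℝ≥0∞) ∂π ≤
      D * ∫⁻ z in {z | z.1 ≠ z.2}, ((W z.1 + W z.2 : ℝ≥0) : ℝ≥0∞) ∂π := by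
  have hm : MeasurableSet {z : PathSpace d T × PathSpace d T | z.1 ≠ z.2} :=
    measurableSet_diag.compl
  have hWm : Measurable fun z : PathSpace d T × PathSpace d T =>
      ((W z.1 + W z.2 : ℝ≥0) : ℝ≥0∞) :=
    ((hW.comp measurable_fst).add (hW.comp measurable_snd)).coe_nnreal_ennreal
  rw [← lintegral_const_mul _ hWm, ← lintegral_indicator hm]
  refine lintegral_mono_ae ?_
  filter_upwards [h] with z hz
  by_cases hd : z.1 = z.2
  · rw [hd, sub_self, pathPow_zero hp]
    simp
  · rw [Set.indicator_of_mem (show z ∈ {z : PathSpace d T × PathSpace d T | z.1 ≠ z.2} from hd)]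
    exact hz

lemma exists_isBicausal (μ ν : Measure (PathSpace d T)) [IsProbabilityMeasure μ]
    [IsProbabilityMeasure ν] : ∃ π, IsBicausal π μ ν := by
  obtain ⟨π, -, -, _, -, h1, h2, h3, h4, -⟩ :=
    exists_prefixCausal_coupling (d := d) (w := fun _ _ => 1) (C := fun _ => 1)
      (fun _ => measurable_const) (fun _ _ => le_rfl) 0 (fun _ _ => by simp) T μ ν 0 μ ν
      (zero_add μ).symm (zero_add ν).symm (fun t ht A hA => by simp)
  exact ⟨π, isBicausal_of_prefixCausal h1 h2 h3 h4⟩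

theorem adaptedWasserstein_rpow_le [IsProbabilityMeasure μ] [IsProbabilityMeasure ν] (hp : p ≠ 0)
    {W : PathSpace d T → ℝ≥0} (hW : Measurable W)
    {D : ℝ≥0∞} (hD : D ≠ ∞) (h : ∀ π, IsBicausal π μ ν → ∀ᵐ z ∂π,
      (pathPow p (z.1 - z.2) : ℝ≥0∞) ≤ D * ((W z.1 + W z.2 : ℝ≥0) : ℝ≥0∞)) :
    adaptedWasserstein p μ ν ^ p ≤ D * weightedATV W μ ν := by
  rw [adaptedWasserstein_rpow hp, weightedATV]
  have : ∀ π, IsBicausal π μ ν →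
      (⨅ (π : Measure (PathSpace d T × PathSpace d T)) (_ : IsBicausal π μ ν),
        ∫⁻ z, (pathPow p (z.1 - z.2) : ℝ≥0∞) ∂π) ≤
      D * ∫⁻ z in {z | z.1 ≠ z.2}, ((W z.1 + W z.2 : ℝ≥0) : ℝ≥0∞) ∂π := fun π hπ =>
    (iInf₂_le π hπ).trans (lintegral_pathPow_sub_le hp hW (h π hπ))
  -- A nonzero `D` can be divided out of the infimum. For `D = 0`, as for a set of diameter zero,
  -- one bicausal coupling of cost zero is needed.
  rcases eq_or_ne D 0 with rfl | hD0
  · obtain ⟨π, hπ⟩ := exists_isBicausal μ ν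
    simpa using this π hπ
  · rw [← ENNReal.div_le_iff' hD0 hD]
    refine le_iInf₂ fun π hπ => ?_
    rw [ENNReal.div_le_iff' hD0 hD]
    exact this π hπ

end Comparison

lemma pathPow_sub_le_lpDiam_rpow {d T : ℕ} {p : ℝ} (hp : 0 < p) {K : Set (PathSpace d T)}
    {x y : PathSpace d T} (hx : x ∈ K) (hy : y ∈ K) :
    (pathPow p (x - y) : ℝ≥0∞) ≤ lpDiam p K ^ p := by
  rw [← ENNReal.rpow_inv_rpow hp.ne' (pathPow p (x - y) : ℝ≥0∞), ← one_div]
  refine ENNReal.rpow_le_rpow ?_ hp.le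
  exact le_iSup₂_of_le x hx (le_iSup₂_of_le y hy le_rfl)

end AdaptedTV

theorem corollary2p7 {d T : ℕ} (hT : 1 ≤ T) (p : ℝ) (hp : 1 ≤ p)
    (μ ν : Measure (AdaptedTV.PathSpace d T)) [IsProbabilityMeasure μ] [IsProbabilityMeasure ν]
    (hμ : AdaptedTV.HasFiniteMoment p μ) (hν : AdaptedTV.HasFiniteMoment p ν) :
    (AdaptedTV.adaptedWasserstein p μ ν ^ p ≤ 2 ^ p * AdaptedTV.atvOrder p μ ν ^ p ∧
      2 ^ p * AdaptedTV.atvOrder p μ ν ^ p ≤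
        2 ^ p * (1 + 2 * ∑ t ∈ Finset.Icc 1 (T - 1),
          ∏ s ∈ Finset.univ.filter (fun s : Fin T => t ≤ s.val),
            (1 + AdaptedTV.momentConst p ν s)) * AdaptedTV.tvOrder p μ ν ^ p) ∧
    ∀ K : Set (AdaptedTV.PathSpace d T), MeasurableSet K → μ Kᶜ = 0 → ν Kᶜ = 0 →
      AdaptedTV.lpDiam p K < ∞ →
      AdaptedTV.adaptedWasserstein p μ ν ^ p ≤
          AdaptedTV.lpDiam p K ^ p * AdaptedTV.atv μ ν ∧
        AdaptedTV.lpDiam p K ^ p * AdaptedTV.atv μ ν ≤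
          (2 * (T : ℝ≥0∞) - 1) * AdaptedTV.lpDiam p K ^ p * AdaptedTV.tv μ ν := by
  have hp0 : 0 < p := by linarith
  have hatv : AdaptedTV.atvOrder p μ ν ^ p =
      AdaptedTV.weightedATV (fun x => 1 + AdaptedTV.pathPow p x) μ ν := by
    rw [AdaptedTV.atvOrder, one_div, ENNReal.rpow_inv_rpow hp0.ne']
  have htv : AdaptedTV.tvOrder p μ ν ^ p =
      AdaptedTV.weightedTV (fun x => 1 + AdaptedTV.pathPow p x) μ ν := by
    rw [AdaptedTV.tvOrder, one_div, ENNReal.rpow_inv_rpow hp0.ne']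
  refine ⟨⟨?_, ?_⟩, fun K hK hμK hνK hdiam => ⟨?_, ?_⟩⟩
  · rw [hatv]
    refine AdaptedTV.adaptedWasserstein_rpow_le hp0.ne'
      ((AdaptedTV.measurable_pathPow p).const_add 1)
      (ENNReal.rpow_ne_top_of_nonneg hp0.le (by simp)) fun π _ => ?_
    exact Filter.Eventually.of_forall fun z => AdaptedTV.pathPow_sub_le_two_rpow hp z.1 z.2
  · rw [hatv, htv, ← AdaptedTV.growthSum_momentFactor, mul_assoc]
    exact mul_le_mul_right (AdaptedTV.weightedATV_le_weightedTV hp0.ne' hμ hν) _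
  · refine AdaptedTV.adaptedWasserstein_rpow_le hp0.ne' measurable_const
      (ENNReal.rpow_ne_top_of_nonneg hp0.le hdiam.ne) fun π hπ => ?_
    have h1 : ∀ᵐ z ∂π, z.1 ∈ K := by
      refine ae_of_ae_map measurable_fst.aemeasurable (p := fun x => x ∈ K) ?_
      rw [hπ.coupling.1]
      exact hμK
    have h2 : ∀ᵐ z ∂π, z.2 ∈ K := by
      refine ae_of_ae_map measurable_snd.aemeasurable (p := fun x => x ∈ K) ?_
      rw [hπ.coupling.2]
      exact hνK
    filter_upwards [h1, h2] with z hz1 hz2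
    refine (AdaptedTV.pathPow_sub_le_lpDiam_rpow hp0 hz1 hz2).trans ?_
    -- The two unit weights add up to `2`, of which only `1 ≤ 2` is used.
    exact le_mul_of_one_le_right' (by norm_num)
  · rw [mul_comm (2 * (T : ℝ≥0∞) - 1), mul_assoc]
    exact mul_le_mul_right (AdaptedTV.atv_le_tv hT) _
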